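/- All graphs are finite and simple. A signed graph $(G,\sigma)$ is a graph $G$ together with a map $\sigma : E(G) \to \{+1,-1\}$; the sign of a walk is the product of the signs of its edges, counted with multiplicity. A homomorphism from $(G,\sigma)$ to a signed graph $(H,\pi)$ is a map $f : V(G) \to V(H)$ that sends edges to edges and preserves the sign of every closed walk. The signed chromatic number $\chi_s((G,\sigma))$ is the minimum order $|V(H)|$ of a signed graph $(H,\pi)$ to which $(G,\sigma)$ admits a homomorphism. For a family $\mathcal F$ of graphs, $\chi_s(\mathcal F)$ denotes the maximum of $\chi_s((G,\sigma))$ over all $G \in \mathcal F$ and all $\sigma : E(G) \to \{+1,-1\}$. Let $\mathcal G^{\rm c}_\Delta$ be the family of connected graphs with maximum degree at most $\Delta$. Theorem. For every integer $\Delta \ge 29$, the maximum $\chi_s(\mathcal G^{\rm c}_\Delta)$ exists and $$2^{\frac{\Delta}{2}-1} \;\le\; \chi_s(\mathcal G^{\rm c}_\Delta) \;\le\; (\Delta-3)(\Delta-1)\,2^{\Delta-1}+2 .$$ -/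

import Mathlib

namespace SignedGraph

/-- A signature on a simple graph `G`: an assignment of a sign `+1` or `-1` to every edge of `G`.
A signed graph is a pair `(G, σ)` with `σ : Signature G`. -/
abbrev Signature {V : Type} (G : SimpleGraph V) : Type := G.edgeSet → ℤˣ

/-- The sign of a walk: the product of the signs of its edges, counted with multiplicity. It is
`1` (positive) iff the walk has an even number of negative edges, and `-1` (negative) otherwise. -/
def walkSign {V : Type} {G : SimpleGraph V} (σ : Signature G) : {u v : V} → G.Walk u v → ℤˣ
  | _, _, SimpleGraph.Walk.nil => 1
  | u, _, @SimpleGraph.Walk.cons _ _ _ v _ h p =>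
      σ ⟨s(u, v), (SimpleGraph.mem_edgeSet G).2 h⟩ * walkSign σ p

/-- A homomorphism of the signed graph `(G, σ)` to the signed graph `(H, π)`: a vertex mapping that
preserves adjacencies and the signs of closed walks. -/
structure Hom {V W : Type} {G : SimpleGraph V} {H : SimpleGraph W}
    (σ : Signature G) (π : Signature H) where
  toHom : G →g H
  walkSign_map : ∀ (v : V) (p : G.Walk v v), walkSign π (p.map toHom) = walkSign σ p

/-- `(G, σ)` admits a homomorphism to some signed graph `(H, π)` of order `k`. -/
def HasHomOfOrder {V : Type} {G : SimpleGraph V} (σ : Signature G) (k : ℕ) : Prop :=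
  ∃ (W : Type) (_ : Fintype W) (H : SimpleGraph W) (π : Signature H),
    Fintype.card W = k ∧ Nonempty (Hom σ π)

/-- The signed chromatic number of `(G, σ)`: the minimum order of a signed graph `(H, π)` such that
`(G, σ)` admits a homomorphism to `(H, π)`. -/
noncomputable def signedChromaticNumber {V : Type} {G : SimpleGraph V} (σ : Signature G) : ℕ :=
  sInf {k : ℕ | HasHomOfOrder σ k}

/-- For a finite graph the minimum defining the signed chromatic number is taken over a nonempty
set, so it is attained. -/
theorem hasHomOfOrder_signedChromaticNumber {V : Type} [Fintype V] {G : SimpleGraph V}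
    (σ : Signature G) : HasHomOfOrder σ (signedChromaticNumber σ) :=
  Nat.sInf_mem (s := {k : ℕ | HasHomOfOrder σ k})
    ⟨Fintype.card V, V, inferInstance, G, σ, rfl,
      ⟨⟨SimpleGraph.Hom.id, fun _ p => by rw [SimpleGraph.Walk.map_id]; rfl⟩⟩⟩

/-- A family of finite simple graphs, given by its membership predicate. -/
abbrev GraphFamily : Type 1 := (V : Type) → [Fintype V] → SimpleGraph V → Prop

/-- The set of the signed chromatic numbers of all signed graphs `(G, σ)` whose underlying graph
`G` belongs to the family `F`. -/
def signedChromaticNumbers (F : GraphFamily) : Set ℕ :=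
  {k : ℕ | ∃ (V : Type) (_ : Fintype V) (G : SimpleGraph V) (σ : Signature G),
    F V G ∧ signedChromaticNumber σ = k}

/-- `k` is the signed chromatic number of the family `F`: the maximum of the signed chromatic
numbers of the signed graphs `(G, σ)` with `G` in `F`; in particular the maximum exists. -/
def IsSignedChromaticNumberOf (F : GraphFamily) (k : ℕ) : Prop :=
  IsGreatest (signedChromaticNumbers F) k

open Classical in
/-- The family of finite connected graphs of maximum degree at most `Δ`. -/
def connectedMaxDegreeLE (Δ : ℕ) : GraphFamily :=
  fun _ _ G => G.Connected ∧ G.maxDegree ≤ Δ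

end SignedGraph

namespace SignedGraph

/-! On a connected graph a homomorphism is the same as a colouring whose colours determine the edge
signs after switching (`exists_switching`, `hasHomOfOrder_of_switching`), so both bounds concern
such colourings.

Upper bound: put `k = Δ - 1` and `t = k (k - 2) 2 ^ k`. A random signing of the complete graph on
`t` vertices realises every sign pattern on `k` vertices, up to a global sign, at least `k` times
(`exists_rich_signing`). Vertices other than the ends of a fixed edge `uv` are mapped greedily into
it, farthest from `u` first. Each then still has an uncoloured neighbour, hence at most `k` coloured
ones; the global sign is absorbed by switching. The neighbours of an uncoloured vertex are kept
distinctly coloured, so that its sign requirements never conflict. Finally `u` and `v` receive two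
new colours.

Lower bound: a bipartite circulant graph with `n Δ` edges has `2 ^ (n Δ)` signatures, while
colouring, switching and target signs give at most `(4 k ^ 2) ^ n * 2 ^ (k ^ 2)` of them. Letting `n
→ ∞` yields `2 ^ Δ ≤ 4 k ^ 2`. -/

/-! ### Walk signs and switching -/

open Classical in
/-- The sign of the edge `xy`, extended by `1` to pairs of non-adjacent vertices. -/
noncomputable def edgeSign {V : Type} {G : SimpleGraph V} (σ : Signature G) (x y : V) : ℤˣ :=
  if h : G.Adj x y then σ ⟨s(x, y), (SimpleGraph.mem_edgeSet G).2 h⟩ else 1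

theorem edgeSign_of_adj {V : Type} {G : SimpleGraph V} (σ : Signature G) {x y : V}
    (h : G.Adj x y) : edgeSign σ x y = σ ⟨s(x, y), (SimpleGraph.mem_edgeSet G).2 h⟩ := by
  simp [edgeSign, h]

theorem edgeSign_comm {V : Type} {G : SimpleGraph V} (σ : Signature G) (x y : V) :
    edgeSign σ x y = edgeSign σ y x := by
  by_cases h : G.Adj x y
  · rw [edgeSign_of_adj σ h, edgeSign_of_adj σ h.symm]
    congr 2
    exact Sym2.eq_swap
  · have h' : ¬ G.Adj y x := fun h' => h h'.symm
    simp [edgeSign, h, h']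

theorem walkSign_cons {V : Type} {G : SimpleGraph V} (σ : Signature G) {u v w : V}
    (h : G.Adj u v) (p : G.Walk v w) :
    walkSign σ (SimpleGraph.Walk.cons h p) = edgeSign σ u v * walkSign σ p := by
  rw [edgeSign_of_adj σ h]; rfl

theorem walkSign_append {V : Type} {G : SimpleGraph V} (σ : Signature G) {u v w : V}
    (p : G.Walk u v) (q : G.Walk v w) :
    walkSign σ (p.append q) = walkSign σ p * walkSign σ q := by
  induction p with
  | nil => simp [walkSign]
  | cons h p ih => rw [SimpleGraph.Walk.cons_append, walkSign_cons, walkSign_cons, ih, mul_assoc]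

theorem walkSign_reverse {V : Type} {G : SimpleGraph V} (σ : Signature G) {u v : V}
    (p : G.Walk u v) : walkSign σ p.reverse = walkSign σ p := by
  induction p with
  | nil => rfl
  | cons h p ih =>
    rw [SimpleGraph.Walk.reverse_cons, walkSign_append, walkSign_cons, walkSign_cons, ih,
      edgeSign_comm]
    simp [walkSign, mul_comm]

/-- A vertex map that, after switching the source at `S`, preserves the signs of all edges
induces a homomorphism to a signed complete graph. -/
theorem hasHomOfOrder_of_switching {V W : Type} [Fintype W] {G : SimpleGraph V} (σ : Signature G)
    (F : V → W) (S : V → ℤˣ) (P : W → W → ℤˣ) (hP : ∀ a b, P a b = P b a)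
    (hne : ∀ x y, G.Adj x y → F x ≠ F y)
    (hF : ∀ x y, G.Adj x y → P (F x) (F y) = S x * S y * edgeSign σ x y) :
    HasHomOfOrder σ (Fintype.card W) := by
  let π : Signature (⊤ : SimpleGraph W) := fun e => Sym2.lift ⟨P, hP⟩ e.1
  let f : G →g (⊤ : SimpleGraph W) := ⟨F, fun {x y} h => hne x y h⟩
  refine ⟨W, inferInstance, ⊤, π, rfl, ⟨⟨f, fun v p => ?_⟩⟩⟩
  have key : ∀ (x y : V) (p : G.Walk x y), walkSign π (p.map f) = S x * S y * walkSign σ p := by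
    intro x y p
    induction p with
    | nil => simp [walkSign]
    | @cons a b c h p ih =>
      rw [SimpleGraph.Walk.map_cons, walkSign_cons, walkSign_cons, ih,
        edgeSign_of_adj π (f.map_adj h)]
      have : π ⟨s(f a, f b), (SimpleGraph.mem_edgeSet _).2 (f.map_adj h)⟩ =
          S a * S b * edgeSign σ a b := hF a b h
      rw [this]
      calc S a * S b * edgeSign σ a b * (S b * S c * walkSign σ p)
          = (S b * S b) * (S a * S c * (edgeSign σ a b * walkSign σ p)) := by
            simp only [mul_assoc, mul_left_comm]
        _ = _ := by rw [Int.units_mul_self, one_mul]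
  rw [key v v p, Int.units_mul_self, one_mul]

/-- On a connected graph, a homomorphism preserves the signs of all edges after a suitable
switching of the source. -/
theorem exists_switching {V W : Type} {G : SimpleGraph V} (hG : G.Connected) {H : SimpleGraph W}
    {σ : Signature G} {π : Signature H} (f : Hom σ π) :
    ∃ S : V → ℤˣ, ∀ x y, G.Adj x y →
      edgeSign σ x y = S x * S y * edgeSign π (f.toHom x) (f.toHom y) := by
  obtain ⟨r⟩ := hG.nonempty
  have hw : ∀ x, Nonempty (G.Walk r x) := fun x => hG.preconnected r x
  let p : ∀ x, G.Walk r x := fun x => (hw x).some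
  refine ⟨fun x => walkSign σ (p x) * walkSign π ((p x).map f.toHom), fun x y h => ?_⟩
  -- The switching at `x` compares the signs of a fixed walk from `r` to `x` and of its image. The
  -- closed walk from `r` through the edge `xy` and back gives the claim for that edge.
  have := f.walkSign_map r ((p x).append (SimpleGraph.Walk.cons h (p y).reverse))
  simp only [SimpleGraph.Walk.map_append, SimpleGraph.Walk.map_cons, walkSign_append,
    walkSign_cons, walkSign_reverse, ← SimpleGraph.Walk.reverse_map] at this
  change edgeSign σ x y = (walkSign σ (p x) * walkSign π ((p x).map f.toHom)) *
    (walkSign σ (p y) * walkSign π ((p y).map f.toHom)) * edgeSign π (f.toHom x) (f.toHom y)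
  clear_value p
  generalize walkSign σ (p x) = a at *
  generalize walkSign σ (p y) = b at *
  generalize walkSign π ((p x).map f.toHom) = c at *
  generalize walkSign π ((p y).map f.toHom) = d at *
  generalize edgeSign σ x y = e at *
  generalize edgeSign π (f.toHom x) (f.toHom y) = g at *
  revert this
  revert a b c d e g
  decide

/-- On a connected graph, a homomorphism to a signed graph of order at most `k` is, after
switching, a colouring by `Fin k` for which the colours determine the edge signs. -/
theorem HasHomOfOrder.exists_coloring {V : Type} {G : SimpleGraph V} (hG : G.Connected)
    {σ : Signature G} {j k : ℕ} (h : HasHomOfOrder σ j) (hjk : j ≤ k) :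
    ∃ (F : V → Fin k) (S : V → ℤˣ) (P : Fin k → Fin k → ℤˣ), ∀ x y, G.Adj x y →
      edgeSign σ x y = S x * S y * P (F x) (F y) := by
  obtain ⟨W, _, H, π, hW, ⟨f⟩⟩ := h
  obtain ⟨S, hS⟩ := exists_switching hG f
  obtain ⟨r⟩ := hG.nonempty
  have : Nonempty W := ⟨f.toHom r⟩
  obtain ⟨e⟩ : Nonempty (W ↪ Fin k) :=
    Function.Embedding.nonempty_of_card_le (by simpa [hW] using hjk)
  refine ⟨fun x => e (f.toHom x), S,
    fun a b => edgeSign π (Function.invFun e a) (Function.invFun e b), fun x y h => ?_⟩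
  simp only [Function.leftInverse_invFun e.injective _]
  exact hS x y h

/-! ### Random signings of complete graphs -/

/-- A product weight over disjoint blocks of coordinates sums to a power of the block sum. -/
theorem sum_prod_blocks {A I E B : Type} [Fintype A] [Fintype I] [Fintype E] [Fintype B]
    [DecidableEq A] [DecidableEq I] [DecidableEq E] [DecidableEq B]
    (e : A × I → E) (he : Function.Injective e) (g : (I → B) → ℝ) :
    (∑ ω : E → B, ∏ a, g (fun i => ω (e (a, i)))) *
        ((Fintype.card B : ℝ) ^ Fintype.card I) ^ Fintype.card A =
      (Fintype.card B : ℝ) ^ Fintype.card E * (∑ h, g h) ^ Fintype.card A := by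
  classical
  -- Coordinates outside the blocks are free and contribute only a power of `card B`.
  let R := {x : E // x ∉ Set.range e}
  let φ : (A × I) ⊕ R ≃ E :=
    ((Equiv.ofInjective e he).sumCongr (Equiv.refl _)).trans (Equiv.Set.sumCompl (Set.range e))
  have hφ : ∀ p, φ (Sum.inl p) = e p := fun p => rfl
  let ψ : (E → B) ≃ (A → I → B) × (R → B) :=
    (φ.arrowCongr (Equiv.refl B)).symm.trans
      ((Equiv.sumArrowEquivProdArrow _ _ _).trans
        ((Equiv.curry A I B).prodCongr (Equiv.refl _)))
  have hψ : ∀ ω a i, (ψ ω).1 a i = ω (e (a, i)) := fun ω a i => by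
    simp [ψ, ← hφ, Function.curry, Equiv.sumArrowEquivProdArrow, Equiv.arrowCongr]
  have hsum : ∑ ω : E → B, ∏ a, g (fun i => ω (e (a, i))) =
      ∑ q : (A → I → B) × (R → B), ∏ a, g (q.1 a) := by
    refine Fintype.sum_equiv ψ _ _ fun ω => ?_
    refine Finset.prod_congr rfl fun a _ => ?_
    exact congrArg g (funext fun i => (hψ ω a i).symm)
  have hcard : Fintype.card E = Fintype.card I * Fintype.card A + Fintype.card R := by
    rw [← Fintype.card_congr φ, Fintype.card_sum, Fintype.card_prod, mul_comm]
  have hpow : (∑ h, g h) ^ Fintype.card A = ∑ q : A → I → B, ∏ a, g (q a) := by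
    have := Finset.prod_univ_sum (fun _ : A => (Finset.univ : Finset (I → B))) fun _ h => g h
    rwa [Fintype.piFinset_univ, Finset.prod_const, Finset.card_univ] at this
  rw [hsum, Fintype.sum_prod_type, hpow, hcard]
  simp only [Finset.sum_const, Finset.card_univ, nsmul_eq_mul, ← Finset.mul_sum,
    Fintype.card_fun]
  push_cast
  rw [pow_add, pow_mul]
  ring

/-- The patterns `α` and `-α` differ because `k > 0`, and each loses `3 / 4` from the total `2 ^ k`.
This is the one-vertex factor of an exponential moment. -/
theorem sum_weight_le {k : ℕ} (hk : 0 < k) (α : Fin k → ℤˣ) :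
    (∑ h : Fin k → ℤˣ, if (∃ s : ℤˣ, ∀ i, h i = s * α i) then (1 / 4 : ℝ) else 1) ≤
      2 ^ k - 3 / 2 := by
  classical
  have h1 : ∀ h : Fin k → ℤˣ, (if (∃ s : ℤˣ, ∀ i, h i = s * α i) then (1 / 4 : ℝ) else 1) =
      1 - 3 / 4 * (if (∃ s : ℤˣ, ∀ i, h i = s * α i) then 1 else 0) := by
    intro h; split_ifs <;> norm_num
  rw [Finset.sum_congr rfl fun h _ => h1 h, Finset.sum_sub_distrib, ← Finset.mul_sum,
    Finset.sum_boole]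
  have h2 : 2 ≤ (Finset.univ.filter
      fun h : Fin k → ℤˣ => ∃ s : ℤˣ, ∀ i, h i = s * α i).card := by
    have hne : α ≠ -α := by
      intro h
      have := congrFun h ⟨0, hk⟩
      simp only [Pi.neg_apply] at this
      revert this
      generalize α ⟨0, hk⟩ = a
      revert a
      decide
    rw [← Finset.card_pair hne]
    refine Finset.card_le_card fun h hh => ?_
    simp only [Finset.mem_insert, Finset.mem_singleton] at hh
    simp only [Finset.mem_filter, Finset.mem_univ, true_and]
    rcases hh with rfl | rfl
    · exact ⟨1, by simp⟩
    · exact ⟨-1, by simp⟩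
  have h3 : (2 : ℝ) ≤ ((Finset.univ.filter
      fun h : Fin k → ℤˣ => ∃ s : ℤˣ, ∀ i, h i = s * α i).card : ℝ) := by exact_mod_cast h2
  simp only [Finset.sum_const, Finset.card_univ, Fintype.card_fun, Fintype.card_units_int,
    Fintype.card_fin, nsmul_eq_mul, mul_one]
  push_cast
  linarith

open Classical in
/-- The number of signings for which fewer than `k` vertices realise the sign pattern `α` on `ι`,
up to a global sign. -/
theorem card_signings_few_le {k t : ℕ} (hk : 0 < k) (ι : Fin k ↪ Fin t) (α : Fin k → ℤˣ) :
    ((Finset.univ.filter fun ω : Sym2 (Fin t) → ℤˣ =>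
      (Finset.univ.filter fun v : {v // v ∉ Set.range ι} =>
        ∃ s : ℤˣ, ∀ i, ω s(v.1, ι i) = s * α i).card < k).card : ℝ) ≤
      4 ^ k * (Fintype.card (Sym2 (Fin t) → ℤˣ) : ℝ) * (1 - 3 / 2 ^ (k + 1)) ^ (t - k) := by
  set A := {v // v ∉ Set.range ι}
  set good : (Sym2 (Fin t) → ℤˣ) → Finset A := fun ω =>
    Finset.univ.filter fun v => ∃ s : ℤˣ, ∀ i, ω s(v.1, ι i) = s * α i with hgood
  -- Exponential Markov argument: each realising vertex costs a factor `1 / 4`, so every bad signing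
  -- has weight at least `(1 / 4) ^ k`.
  let g : (Fin k → ℤˣ) → ℝ := fun h =>
    if (∃ s : ℤˣ, ∀ i, h i = s * α i) then (1 / 4 : ℝ) else 1
  let e : A × Fin k → Sym2 (Fin t) := fun p => s(p.1.1, ι p.2)
  -- Different outside vertices use disjoint sets of edges to the range of `ι`, hence are
  -- independent.
  have he : Function.Injective e := by
    rintro ⟨⟨v, hv⟩, i⟩ ⟨⟨v', hv'⟩, i'⟩ h
    simp only [e, Sym2.eq_iff] at h
    rcases h with ⟨h1, h2⟩ | ⟨h1, h2⟩
    · simp [h1, ι.injective h2]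
    · exact absurd ⟨i', h1.symm⟩ hv
  have hA : Fintype.card A = t - k := by
    rw [Fintype.card_subtype_compl, Fintype.card_fin,
      show Fintype.card {x // x ∈ Set.range ι} = Fintype.card (Fin k) from
        Set.card_range_of_injective ι.injective, Fintype.card_fin]
  have key := sum_prod_blocks e he g
  have hprod : ∀ ω : Sym2 (Fin t) → ℤˣ,
      ∏ a, g (fun i => ω (e (a, i))) = (1 / 4) ^ (good ω).card := by
    intro ω
    simp only [g, e, hgood, Finset.prod_ite, Finset.prod_const, one_pow, mul_one]
  simp only [hprod, hA, Fintype.card_units_int, Fintype.card_fin] at key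
  have hsum := sum_weight_le hk α
  have hsum0 : 0 ≤ ∑ h, g h := Finset.sum_nonneg fun h _ => by
    simp only [g]; split_ifs <;> norm_num
  set bad := Finset.univ.filter fun ω => (good ω).card < k with hbad
  have hlow : (bad.card : ℝ) * (1 / 4) ^ k ≤ ∑ ω, (1 / 4 : ℝ) ^ (good ω).card := by
    rw [← nsmul_eq_mul, ← Finset.sum_const]
    refine (Finset.sum_le_sum fun ω hω => ?_).trans
      (Finset.sum_le_sum_of_subset_of_nonneg (Finset.subset_univ bad) fun _ _ _ => by positivity)
    have : (good ω).card < k := by simpa [hbad] using hω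
    exact pow_le_pow_of_le_one (by norm_num) (by norm_num) this.le
  have hup : (∑ ω, (1 / 4 : ℝ) ^ (good ω).card) ≤
      (Fintype.card (Sym2 (Fin t) → ℤˣ) : ℝ) * (1 - 3 / 2 ^ (k + 1)) ^ (t - k) := by
    have hpos : (0 : ℝ) < ((2 : ℝ) ^ k) ^ (t - k) := by positivity
    refine le_of_mul_le_mul_right ?_ hpos
    push_cast at key
    rw [key, mul_assoc, ← mul_pow]
    have h2 : (1 - 3 / 2 ^ (k + 1)) * (2 : ℝ) ^ k = 2 ^ k - 3 / 2 := by
      rw [pow_succ]; field_simp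
    rw [h2, Fintype.card_fun]
    simp only [Fintype.card_units_int]
    push_cast
    gcongr
  have h4 : (0 : ℝ) < 4 ^ k := by positivity
  calc (bad.card : ℝ) = 4 ^ k * ((bad.card : ℝ) * (1 / 4) ^ k) := by
        rw [one_div, inv_pow]; field_simp
    _ ≤ 4 ^ k * ((Fintype.card (Sym2 (Fin t) → ℤˣ) : ℝ) * (1 - 3 / 2 ^ (k + 1)) ^ (t - k)) := by
        exact mul_le_mul_of_nonneg_left (hlow.trans hup) h4.le
    _ = _ := by ring

/-- There are at most `t ^ k * 2 ^ k` pairs of a `k`-tuple and a pattern. Since `3 t / 2 ^ (k + 1) =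
(3 / 2) k (k - 2)` and `exp (-3 / 2) ≤ 1 / 4`, the failure probability is of order `4 ^ (-k (k -
2))`. The product is then at most the `k`-th power of `384 k ^ 2 / 2 ^ k`. -/
theorem union_bound_lt_one {k t : ℕ} (hk : 28 ≤ k) (ht : t = k * (k - 2) * 2 ^ k) :
    (t : ℝ) ^ k * 2 ^ k * (4 ^ k * (1 - 3 / 2 ^ (k + 1)) ^ (t - k)) < 1 := by
  obtain ⟨m, rfl⟩ : ∃ m, k = m + 2 := ⟨k - 2, by omega⟩
  set k := m + 2 with hkm
  have hk2 : k - 2 = m := by omega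
  rw [hk2] at ht
  have hpow : ∀ m : ℕ, 26 ≤ m → 128 * 3 * (m + 2) ^ 2 < 2 ^ (m + 2) := by
    intro m hm
    induction m, hm using Nat.le_induction with
    | base => norm_num
    | succ n hn ih =>
      rw [show n + 1 + 2 = n + 2 + 1 from rfl, pow_succ 2]
      nlinarith
  have hbig : (128 * 3 * (k : ℝ) ^ 2) < 2 ^ k := by exact_mod_cast hpow m (by omega)
  have hk0 : (28 : ℝ) ≤ k := by exact_mod_cast hk
  have h2k : (0 : ℝ) < 2 ^ k := by positivity
  have hkt : k ≤ t := by
    rw [ht]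
    have : 1 ≤ 2 ^ k := Nat.one_le_two_pow
    have hm : 1 ≤ m := by omega
    calc k = k * 1 * 1 := by ring
      _ ≤ k * m * 2 ^ k := by gcongr
  have h0 : (0 : ℝ) ≤ 1 - 3 / 2 ^ (k + 1) := by
    rw [sub_nonneg, div_le_one (by positivity), pow_succ]
    nlinarith
  have hq : (1 - 3 / 2 ^ (k + 1) : ℝ) ^ (t - k) ≤ 3 / 4 ^ (k * m) := by
    have h1 : (1 - 3 / 2 ^ (k + 1) : ℝ) ≤ Real.exp (-(3 / 2 ^ (k + 1))) :=
      Real.one_sub_le_exp_neg _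
    calc (1 - 3 / 2 ^ (k + 1) : ℝ) ^ (t - k) ≤ Real.exp (-(3 / 2 ^ (k + 1))) ^ (t - k) := by
          gcongr
      _ = Real.exp (3 * k / 2 ^ (k + 1)) * Real.exp (-(3 / 2)) ^ (k * m) := by
          rw [← Real.exp_nat_mul, ← Real.exp_nat_mul, ← Real.exp_add, Nat.cast_sub hkt, ht]
          congr 1
          push_cast
          rw [pow_succ]
          field_simp
          ring
      _ ≤ 3 * (1 / 4) ^ (k * m) := by
          have e1 : Real.exp (3 * k / 2 ^ (k + 1)) ≤ 3 := by
            have : 3 * (k : ℝ) / 2 ^ (k + 1) ≤ 1 := by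
              rw [div_le_one (by positivity), pow_succ]
              nlinarith
            exact (Real.exp_le_exp.2 this).trans (by linarith [Real.exp_one_lt_d9])
          have e2 : Real.exp (-(3 / 2)) ≤ 1 / 4 := by
            rw [Real.exp_neg, one_div]
            apply inv_anti₀ (by norm_num)
            have h3 : Real.exp (3 / 2) ^ 2 = Real.exp 1 ^ 3 := by
              rw [← Real.exp_nat_mul, ← Real.exp_nat_mul]; norm_num
            have h4 : (2.7 : ℝ) ^ 3 ≤ Real.exp 1 ^ 3 := by
              gcongr
              linarith [Real.exp_one_gt_d9]
            nlinarith [Real.exp_pos (3 / 2)]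
          gcongr
      _ = _ := by rw [one_div, inv_pow]; field_simp
  have htk : (t : ℝ) ≤ k ^ 2 * 2 ^ k := by
    rw [ht]; push_cast
    have : (m : ℝ) ≤ k := by rw [hkm]; push_cast; linarith
    rw [sq]
    gcongr
  calc (t : ℝ) ^ k * 2 ^ k * (4 ^ k * (1 - 3 / 2 ^ (k + 1)) ^ (t - k))
      ≤ (k ^ 2 * 2 ^ k : ℝ) ^ k * 2 ^ k * (4 ^ k * (3 / 4 ^ (k * m))) := by
        have := pow_nonneg h0 (t - k)
        gcongr
    _ ≤ (k ^ 2 * 2 ^ k : ℝ) ^ k * 2 ^ k * (4 ^ k * (3 ^ k / 4 ^ (k * m))) := by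
        gcongr
        exact le_self_pow₀ (by norm_num) (by omega)
    _ = ((k : ℝ) ^ 2 * 2 ^ k * 8 * 3 / 4 ^ m) ^ k := by
        rw [mul_comm k m, pow_mul (4 : ℝ) m k, div_pow, mul_pow _ (3 : ℝ), mul_pow _ (8 : ℝ),
          show (8 : ℝ) = 2 * 4 by norm_num, mul_pow (2 : ℝ) 4]
        ring
    _ < 1 := by
        refine pow_lt_one₀ (by positivity) ?_ (by omega)
        rw [div_lt_one (by positivity)]
        have h4m : (16 : ℝ) * 4 ^ m = 2 ^ k * 2 ^ k := by
          rw [← mul_pow, hkm, pow_add]; norm_num; ring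
        nlinarith

open Classical in
/-- There is a signing of the complete graph on `k (k - 2) 2 ^ k` vertices for which every sign
pattern on every `k` vertices is realised, up to a global sign, by at least `k` other vertices. -/
theorem exists_rich_signing {k t : ℕ} (hk : 28 ≤ k) (ht : t = k * (k - 2) * 2 ^ k) :
    ∃ ω : Sym2 (Fin t) → ℤˣ, ∀ (ι : Fin k ↪ Fin t) (α : Fin k → ℤˣ),
      k ≤ (Finset.univ.filter fun v : {v // v ∉ Set.range ι} =>
        ∃ s : ℤˣ, ∀ i, ω s(v.1, ι i) = s * α i).card := by
  by_contra! hcon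
  let bad : (Fin k ↪ Fin t) × (Fin k → ℤˣ) → Finset (Sym2 (Fin t) → ℤˣ) := fun q =>
    Finset.univ.filter fun ω : Sym2 (Fin t) → ℤˣ =>
      (Finset.univ.filter fun v : {v // v ∉ Set.range q.1} =>
        ∃ s : ℤˣ, ∀ i, ω s(v.1, q.1 i) = s * q.2 i).card < k
  have hcover : (Finset.univ : Finset (Sym2 (Fin t) → ℤˣ)) ⊆ Finset.univ.biUnion bad := by
    intro ω _
    obtain ⟨ι, α, h⟩ := hcon ω
    exact Finset.mem_biUnion.2 ⟨(ι, α), Finset.mem_univ _, by simpa [bad] using h⟩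
  set N := Fintype.card (Sym2 (Fin t) → ℤˣ) with hN
  have hN0 : (0 : ℝ) < N := by
    rw [hN]; exact_mod_cast Fintype.card_pos
  have h1 : (N : ℝ) ≤ ∑ q, ((bad q).card : ℝ) := by
    have := (Finset.card_le_card hcover).trans Finset.card_biUnion_le
    rw [Finset.card_univ] at this
    exact_mod_cast this
  have h2 : ∑ q, ((bad q).card : ℝ) ≤
      ∑ _q : (Fin k ↪ Fin t) × (Fin k → ℤˣ),
        4 ^ k * (N : ℝ) * (1 - 3 / 2 ^ (k + 1)) ^ (t - k) :=
    Finset.sum_le_sum fun q _ => card_signings_few_le (by omega) q.1 q.2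
  have hq0 : (0 : ℝ) ≤ 1 - 3 / 2 ^ (k + 1) := by
    rw [sub_nonneg, div_le_one (by positivity)]
    calc (3 : ℝ) ≤ 2 ^ 2 := by norm_num
      _ ≤ 2 ^ (k + 1) := pow_le_pow_right₀ (by norm_num) (by omega)
  have h3 : (Fintype.card ((Fin k ↪ Fin t) × (Fin k → ℤˣ)) : ℝ) ≤ (t : ℝ) ^ k * 2 ^ k := by
    rw [Fintype.card_prod, Fintype.card_fun, Fintype.card_embedding_eq]
    simp only [Fintype.card_fin, Fintype.card_units_int]
    push_cast
    gcongr
    exact_mod_cast Nat.descFactorial_le_pow t k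
  rw [Finset.sum_const, Finset.card_univ, nsmul_eq_mul] at h2
  have h4 := union_bound_lt_one hk ht
  have h5 : (N : ℝ) ≤ N * ((t : ℝ) ^ k * 2 ^ k * (4 ^ k * (1 - 3 / 2 ^ (k + 1)) ^ (t - k))) :=
    calc (N : ℝ) ≤ _ := h1.trans h2
      _ ≤ (t : ℝ) ^ k * 2 ^ k * (4 ^ k * (N : ℝ) * (1 - 3 / 2 ^ (k + 1)) ^ (t - k)) := by gcongr
      _ = _ := by ring
  nlinarith

/-! ### The extension property -/

open Classical in
/-- If every sign pattern on every `k` vertices is realised, up to a global sign, by at least `k`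
other vertices, then a pattern on `i` vertices with `1 ≤ i ≤ k` is realised `2 ^ (k - i) * k`
times. -/
theorem rich_of_le {k t : ℕ} (hkt : k ≤ t) (ω : Sym2 (Fin t) → ℤˣ)
    (hω : ∀ (ι : Fin k ↪ Fin t) (α : Fin k → ℤˣ),
      k ≤ (Finset.univ.filter fun v : {v // v ∉ Set.range ι} =>
        ∃ s : ℤˣ, ∀ i, ω s(v.1, ι i) = s * α i).card) (n : ℕ) :
    ∀ (J : Finset (Fin t)) (β : Fin t → ℤˣ), J.Nonempty → J.card + n = k →
      2 ^ n * k ≤ (Finset.univ.filter fun v : Fin t =>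
        v ∉ J ∧ ∃ s : ℤˣ, ∀ j ∈ J, ω s(v, j) = s * β j).card := by
  induction n with
  | zero =>
    intro J β _ hJ
    let ι : Fin k ↪ Fin t := (J.orderEmbOfFin hJ).toEmbedding
    have hr : ∀ j, j ∈ Set.range ι ↔ j ∈ J := fun j => by
      have := Finset.range_orderEmbOfFin J hJ
      change j ∈ Set.range (J.orderEmbOfFin hJ) ↔ _
      rw [this]; rfl
    rw [pow_zero, one_mul]
    refine (hω ι fun i => β (ι i)).trans ?_
    rw [← Finset.card_map (Function.Embedding.subtype _)]
    refine Finset.card_le_card fun v hv => ?_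
    simp only [Finset.mem_map, Finset.mem_filter, Finset.mem_univ, true_and,
      Function.Embedding.subtype_apply, Subtype.exists, exists_and_right, exists_eq_right] at hv ⊢
    obtain ⟨hv, s, hs⟩ := hv
    refine ⟨fun h => hv ((hr v).2 h), s, fun j hj => ?_⟩
    obtain ⟨i, rfl⟩ := (hr j).2 hj
    exact hs i
  | succ n ih =>
    intro J β hne hJ
    obtain ⟨j, hj⟩ : ∃ j, j ∉ J := by
      by_contra! h
      have : J = Finset.univ := Finset.eq_univ_iff_forall.2 h
      rw [this, Finset.card_univ, Fintype.card_fin] at hJ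
      omega
    have hcard : (insert j J).card + n = k := by
      rw [Finset.card_insert_of_notMem hj]; omega
    have h := fun a : ℤˣ => ih (insert j J) (Function.update β j a) (Finset.insert_nonempty _ _) hcard
    have hβ : ∀ a, ∀ i ∈ J, Function.update β j a i = β i := fun a i hi =>
      Function.update_of_ne (ne_of_mem_of_not_mem hi hj) _ _
    set M := fun a : ℤˣ => Finset.univ.filter fun v : Fin t =>
        v ∉ insert j J ∧ ∃ s : ℤˣ, ∀ i ∈ insert j J, ω s(v, i) = s * Function.update β j a i with hM
    -- A vertex of the nonempty `J` fixes the global sign, so no witness serves both extensions to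
    -- `j`. Hence each removed vertex doubles the count.
    have hdisj : Disjoint (M 1) (M (-1)) := by
      rw [Finset.disjoint_left]
      intro v hv hv'
      simp only [hM, Finset.mem_filter, Finset.mem_univ, true_and] at hv hv'
      obtain ⟨-, s, hs⟩ := hv
      obtain ⟨-, s', hs'⟩ := hv'
      obtain ⟨i, hi⟩ := hne
      have e1 := (hs i (Finset.mem_insert_of_mem hi)).symm.trans
        (hs' i (Finset.mem_insert_of_mem hi))
      rw [hβ _ i hi, hβ _ i hi] at e1
      have e2 := (hs j (Finset.mem_insert_self _ _)).symm.trans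
        (hs' j (Finset.mem_insert_self _ _))
      rw [Function.update_self, Function.update_self, mul_right_cancel e1] at e2
      exact absurd (mul_left_cancel e2) (by decide)
    calc 2 ^ (n + 1) * k = 2 ^ n * k + 2 ^ n * k := by ring
      _ ≤ (M 1).card + (M (-1)).card := add_le_add (h 1) (h (-1))
      _ = (M 1 ∪ M (-1)).card := (Finset.card_union_of_disjoint hdisj).symm
      _ ≤ _ := by
        refine Finset.card_le_card (Finset.union_subset ?_ ?_) <;>
        · intro v hv
          simp only [hM, Finset.mem_filter, Finset.mem_univ, true_and, Finset.mem_insert,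
            not_or] at hv ⊢
          obtain ⟨⟨-, hv⟩, s, hs⟩ := hv
          exact ⟨hv, s, fun i hi => by rw [hs i (Or.inr hi), hβ _ i hi]⟩

/-- The extension property used for greedy colouring: a sign pattern on at most `k` vertices is
realised, up to a global sign, by another vertex outside any set of forbidden vertices that is not
too large. -/
theorem exists_greedy_target {k t : ℕ} (hk : 28 ≤ k) (ht : t = k * (k - 2) * 2 ^ k) :
    ∃ ω : Sym2 (Fin t) → ℤˣ, ∀ (J B : Finset (Fin t)) (β : Fin t → ℤˣ), J.card ≤ k →
      B.card ≤ (k + 1 - J.card) * (k - 1) →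
      ∃ c, c ∉ J ∧ c ∉ B ∧ ∃ s : ℤˣ, ∀ j ∈ J, ω s(c, j) = s * β j := by
  classical
  obtain ⟨ω, hω⟩ := exists_rich_signing hk ht
  have hbig : (k + 1) * (k - 1) < t := by
    obtain ⟨m, rfl⟩ : ∃ m, k = m + 2 := ⟨k - 2, by omega⟩
    have h4 : 4 ≤ 2 ^ (m + 2) := by
      calc 4 = 2 ^ 2 := rfl
        _ ≤ _ := Nat.pow_le_pow_right (by norm_num) (by omega)
    have e1 : m + 2 - 2 = m := by omega
    have e2 : m + 2 - 1 = m + 1 := by omega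
    rw [ht, e1, e2]
    calc (m + 2 + 1) * (m + 1) < (m + 2) * m * 4 := by nlinarith
      _ ≤ _ := by gcongr
  have hkt : k ≤ t := by
    have : k + 1 ≤ (k + 1) * (k - 1) := Nat.le_mul_of_pos_right _ (by omega)
    omega
  refine ⟨ω, fun J B β hJ hB => ?_⟩
  set M := Finset.univ.filter fun v : Fin t =>
    v ∉ J ∧ ∃ s : ℤˣ, ∀ j ∈ J, ω s(v, j) = s * β j with hM
  have hlt : B.card < M.card := by
    -- For empty `J` every vertex qualifies and the size of `t` suffices; otherwise `i + 1 ≤ 2 ^ i`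
    -- with `i = k - J.card`.
    rcases J.eq_empty_or_nonempty with rfl | hne
    · have : M = Finset.univ := by
        rw [hM]; ext v; simp
      rw [this, Finset.card_univ, Fintype.card_fin]
      simp only [Finset.card_empty, Nat.sub_zero] at hB
      omega
    · have h := rich_of_le hkt ω hω (k - J.card) J β hne (by omega)
      refine lt_of_lt_of_le ?_ h
      have h1 : k + 1 - J.card ≤ 2 ^ (k - J.card) := by
        have := (k - J.card).lt_two_pow_self
        omega
      calc B.card ≤ (k + 1 - J.card) * (k - 1) := hB
        _ ≤ 2 ^ (k - J.card) * (k - 1) := by gcongr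
        _ < 2 ^ (k - J.card) * k := Nat.mul_lt_mul_of_pos_left (by omega) (by positivity)
  obtain ⟨c, hc, hcB⟩ := Finset.exists_mem_notMem_of_card_lt_card hlt
  simp only [hM, Finset.mem_filter, Finset.mem_univ, true_and] at hc
  exact ⟨c, hc.1, hcB, hc.2⟩

/-! ### Greedy colouring -/

open Classical in
/-- Greedy colouring of all vertices but the ends of an edge `uv`, by decreasing distance to `u`.
The earlier neighbours of a vertex still to be coloured always have pairwise distinct colours. -/
theorem exists_greedy_coloring {V : Type} [Fintype V] {G : SimpleGraph V} (hG : G.Connected)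
    {k t : ℕ} (hk : 1 ≤ k) (hdeg : ∀ x, G.degree x ≤ k + 1) (σ : Signature G) {u v : V}
    (huv : G.Adj u v) (ω : Sym2 (Fin t) → ℤˣ) (c₀ : Fin t)
    (hω : ∀ (J B : Finset (Fin t)) (β : Fin t → ℤˣ), J.card ≤ k →
      B.card ≤ (k + 1 - J.card) * (k - 1) →
      ∃ c, c ∉ J ∧ c ∉ B ∧ ∃ s : ℤˣ, ∀ j ∈ J, ω s(c, j) = s * β j) (A : Finset V) :
    (∀ x ∈ A, x ≠ u ∧ x ≠ v ∧ ∀ y, y ≠ u → y ≠ v → G.dist u x < G.dist u y → y ∈ A) →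
    ∃ (f : V → Fin t) (S : V → ℤˣ),
      (∀ x ∈ A, ∀ y ∈ A, G.Adj x y → f x ≠ f y ∧ ω s(f x, f y) = S x * S y * edgeSign σ x y) ∧
      ∀ z, z ∉ A → Set.InjOn f {x | x ∈ A ∧ G.Adj z x} := by
  -- Every uncoloured vertex has an uncoloured neighbour: `u` and `v` have each other, and any other
  -- has the next vertex of a shortest walk to `u`, which is coloured later if at all.
  have hfree : ∀ A : Finset V,
      (∀ x ∈ A, x ≠ u ∧ x ≠ v ∧ ∀ y, y ≠ u → y ≠ v → G.dist u x < G.dist u y → y ∈ A) →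
      ∀ x, x ∉ A → ∃ y, G.Adj x y ∧ y ∉ A := by
    intro A hA x hx
    by_cases hxu : x = u
    · subst hxu; exact ⟨v, huv, fun h => (hA v h).2.1 rfl⟩
    by_cases hxv : x = v
    · subst hxv; exact ⟨u, huv.symm, fun h => (hA u h).1 rfl⟩
    obtain ⟨p, hp⟩ := hG.exists_walk_length_eq_dist x u
    cases p with
    | nil => exact absurd rfl hxu
    | @cons _ y _ h q =>
      refine ⟨y, h, fun hy => hx ((hA y hy).2.2 x hxu hxv ?_)⟩
      rw [SimpleGraph.Walk.length_cons] at hp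
      have := SimpleGraph.dist_le q
      rw [SimpleGraph.dist_comm, G.dist_comm (u := u) (v := x)]
      omega
  induction A using Finset.induction_on_min_value (fun x => G.dist u x) with
  | empty => exact fun _ => ⟨fun _ => c₀, fun _ => 1, by simp, by simp⟩
  | insert w A hw hmin ih =>
    intro hA'
    have hA : ∀ x ∈ A, x ≠ u ∧ x ≠ v ∧
        ∀ y, y ≠ u → y ≠ v → G.dist u x < G.dist u y → y ∈ A := by
      intro x hx
      obtain ⟨h1, h2, h3⟩ := hA' x (Finset.mem_insert_of_mem hx)
      refine ⟨h1, h2, fun y hyu hyv hy => ?_⟩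
      rcases Finset.mem_insert.1 (h3 y hyu hyv hy) with rfl | h
      · exact absurd (hmin x hx) (by simpa using hy)
      · exact h
    obtain ⟨f, S, hcol, hinj⟩ := ih hA
    set N := (G.neighborFinset w).filter (· ∈ A) with hN
    have hNmem : ∀ y, y ∈ N ↔ y ∈ A ∧ G.Adj w y := fun y => by
      simp [hN, and_comm]
    have hfN : Set.InjOn f N := fun x hx y hy h =>
      hinj w hw ((hNmem x).1 hx) ((hNmem y).1 hy) h
    have hJcard : (N.image f).card = N.card := Finset.card_image_of_injOn hfN
    have hNk : N.card ≤ k := by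
      obtain ⟨y, hwy, hy⟩ := hfree A hA w hw
      have : N ⊂ G.neighborFinset w := by
        refine Finset.ssubset_iff_subset_ne.2 ⟨Finset.filter_subset _ _, fun h => hy ?_⟩
        have : y ∈ N := by rw [h]; simpa using hwy
        exact ((hNmem y).1 this).1
      have := Finset.card_lt_card this
      rw [SimpleGraph.card_neighborFinset_eq_degree] at this
      have := hdeg w
      omega
    -- Colours that would break injectivity around an uncoloured neighbour `z` of `w`. Each `z`
    -- contributes at most `k - 1`, as neither `w` nor a further uncoloured neighbour counts.
    let B := ((G.neighborFinset w).filter (· ∉ A)).biUnion fun z =>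
      ((G.neighborFinset z).filter (· ∈ A)).image f
    have hB : B.card ≤ (k + 1 - (N.image f).card) * (k - 1) := by
      have h1 : ((G.neighborFinset w).filter (· ∉ A)).card ≤ k + 1 - N.card := by
        have : N.card + ((G.neighborFinset w).filter (· ∉ A)).card = _ :=
          Finset.card_filter_add_card_filter_not (s := G.neighborFinset w) (· ∈ A)
        rw [SimpleGraph.card_neighborFinset_eq_degree] at this
        have := hdeg w
        omega
      rw [hJcard]
      refine (Finset.card_biUnion_le_card_mul _ _ (k - 1) fun z hz => ?_).trans
        (Nat.mul_le_mul_right _ h1)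
      refine Finset.card_image_le.trans ?_
      simp only [Finset.mem_filter, SimpleGraph.mem_neighborFinset] at hz
      obtain ⟨hwz, hzA⟩ := hz
      obtain ⟨y, hzy, hy⟩ := hfree _ hA' z (by simp [hzA, hwz.ne'])
      simp only [Finset.mem_insert, not_or] at hy
      have hsub : (G.neighborFinset z).filter (· ∈ A) ⊆
          ((G.neighborFinset z).erase w).erase y := by
        intro x hx
        simp only [Finset.mem_filter, SimpleGraph.mem_neighborFinset, Finset.mem_erase] at hx ⊢
        exact ⟨fun h => hy.2 (h ▸ hx.2), fun h => hw (h ▸ hx.2), hx.1⟩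
      refine (Finset.card_le_card hsub).trans ?_
      rw [Finset.card_erase_of_mem, Finset.card_erase_of_mem,
        SimpleGraph.card_neighborFinset_eq_degree]
      · have := hdeg z; omega
      · simpa using hwz.symm
      · simpa [hy.1] using hzy
    -- Required signs towards the colours around `w`, well defined since `f` is injective on `N`;
    -- the default `1` is irrelevant.
    let β : Fin t → ℤˣ := fun c =>
      if h : ∃ y, y ∈ N ∧ f y = c then S h.choose * edgeSign σ w h.choose else 1
    have hβ : ∀ y ∈ N, β (f y) = S y * edgeSign σ w y := by
      intro y hy
      have h : ∃ y', y' ∈ N ∧ f y' = f y := ⟨y, hy, rfl⟩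
      have he : h.choose = y := hfN h.choose_spec.1 hy h.choose_spec.2
      simp only [β, dif_pos h, he]
    obtain ⟨c, hcJ, hcB, s, hs⟩ := hω (N.image f) B β (hJcard ▸ hNk) hB
    have hne : ∀ x ∈ A, x ≠ w := fun x hx h => hw (h ▸ hx)
    have hnew : ∀ y ∈ A, G.Adj w y → c ≠ f y ∧ ω s(c, f y) = s * S y * edgeSign σ w y := by
      intro y hy hwy
      have hyN := (hNmem y).2 ⟨hy, hwy⟩
      have hyJ := Finset.mem_image_of_mem f hyN
      refine ⟨fun h => hcJ (h ▸ hyJ), ?_⟩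
      rw [hs _ hyJ, hβ y hyN, mul_assoc]
    -- The global sign `s` becomes the switching at `w`.
    refine ⟨Function.update f w c, Function.update S w s, ?_, ?_⟩
    · intro x hx y hy hxy
      rcases Finset.mem_insert.1 hx with rfl | hx' <;> rcases Finset.mem_insert.1 hy with rfl | hy'
      · exact absurd hxy (G.loopless.irrefl _)
      · rw [Function.update_self, Function.update_self, Function.update_of_ne (hne y hy'),
          Function.update_of_ne (hne y hy')]
        exact hnew y hy' hxy
      · rw [Function.update_self, Function.update_self, Function.update_of_ne (hne x hx'),
          Function.update_of_ne (hne x hx'), Sym2.eq_swap, edgeSign_comm, mul_comm (S x) s]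
        exact ⟨(hnew x hx' hxy.symm).1.symm, (hnew x hx' hxy.symm).2⟩
      · rw [Function.update_of_ne (hne y hy'), Function.update_of_ne (hne y hy'),
          Function.update_of_ne (hne x hx'), Function.update_of_ne (hne x hx')]
        exact hcol x hx' y hy' hxy
    · intro z hz
      simp only [Finset.mem_insert, not_or] at hz
      have hcz : G.Adj z w → ∀ x ∈ A, G.Adj z x → c ≠ f x := by
        intro hzw x hx hzx h
        refine hcB (Finset.mem_biUnion.2 ⟨z, ?_, Finset.mem_image.2 ⟨x, ?_, h.symm⟩⟩)
        · simp [hz.2, hzw.symm]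
        · simp [hx, hzx]
      rintro x ⟨hx, hzx⟩ y ⟨hy, hzy⟩ h
      rcases Finset.mem_insert.1 hx with rfl | hx' <;> rcases Finset.mem_insert.1 hy with rfl | hy'
      · rfl
      · rw [Function.update_self, Function.update_of_ne (hne y hy')] at h
        exact absurd h (hcz hzx y hy' hzy)
      · rw [Function.update_self, Function.update_of_ne (hne x hx')] at h
        exact absurd h.symm (hcz hzy x hx' hzx)
      · rw [Function.update_of_ne (hne y hy'), Function.update_of_ne (hne x hx')] at h
        exact hinj z hz.2 ⟨hx', hzx⟩ ⟨hy', hzy⟩ h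

theorem signedChromaticNumber_le {V : Type} {G : SimpleGraph V} {σ : Signature G} {k : ℕ}
    (h : HasHomOfOrder σ k) : signedChromaticNumber σ ≤ k :=
  Nat.sInf_le h

open Classical in
/-- Colour all but the ends of an edge by the greedy colouring, and give the two ends two new
colours. -/
theorem hasHomOfOrder_of_adj {V : Type} [Fintype V] {G : SimpleGraph V} (hG : G.Connected)
    {k t : ℕ} (hk : 28 ≤ k) (ht : t = k * (k - 2) * 2 ^ k) (hdeg : ∀ x, G.degree x ≤ k + 1)
    (σ : Signature G) {u v : V} (huv : G.Adj u v) : HasHomOfOrder σ (t + 2) := by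
  obtain ⟨ω, hω⟩ := exists_greedy_target hk ht
  obtain ⟨c₀, -⟩ := hω ∅ ∅ (fun _ => 1) (by simp) (by simp)
  obtain ⟨f, S, hcol, hinj⟩ := exists_greedy_coloring hG (by omega) hdeg σ huv ω c₀ hω
    ((Finset.univ.erase u).erase v) (by
      intro x hx
      simp only [Finset.mem_erase, Finset.mem_univ, and_true] at hx ⊢
      exact ⟨hx.2, hx.1, fun y hu hv _ => ⟨hv, hu⟩⟩)
  simp only [Finset.mem_erase, Finset.mem_univ, and_true] at hcol hinj
  -- Signs between an end `z` and the old colours, chosen freely because the neighbours of `z` have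
  -- distinct colours.
  let γ : V → Fin t → ℤˣ := fun z c =>
    if h : ∃ y, (y ≠ v ∧ y ≠ u) ∧ G.Adj z y ∧ f y = c then
      S h.choose * edgeSign σ z h.choose else 1
  have hγ : ∀ z, (z = u ∨ z = v) → ∀ y, y ≠ v → y ≠ u → G.Adj z y →
      γ z (f y) = S y * edgeSign σ z y := by
    intro z hz y hyv hyu hzy
    have h : ∃ y', (y' ≠ v ∧ y' ≠ u) ∧ G.Adj z y' ∧ f y' = f y := ⟨y, ⟨hyv, hyu⟩, hzy, rfl⟩
    have he : h.choose = y := hinj z (by tauto) ⟨h.choose_spec.1, h.choose_spec.2.1⟩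
      ⟨⟨hyv, hyu⟩, hzy⟩ h.choose_spec.2.2
    simp only [γ, dif_pos h, he]
  let P : Fin t ⊕ Bool → Fin t ⊕ Bool → ℤˣ
    | .inl a, .inl b => ω s(a, b)
    | .inl a, .inr b => γ (if b then v else u) a
    | .inr b, .inl a => γ (if b then v else u) a
    | .inr _, .inr _ => edgeSign σ u v
  let F : V → Fin t ⊕ Bool := fun x =>
    if x = u then .inr false else if x = v then .inr true else .inl (f x)
  let S' : V → ℤˣ := fun x => if x = u ∨ x = v then 1 else S x
  have hP : ∀ a b, P a b = P b a := by
    rintro (a | a) (b | b)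
    · exact congrArg ω Sym2.eq_swap
    all_goals rfl
  have hvu : v ≠ u := huv.ne'
  have hFu : F u = .inr false := by simp [F]
  have hFv : F v = .inr true := by simp [F, hvu]
  have hF : ∀ x, x ≠ u → x ≠ v → F x = .inl (f x) := fun x h1 h2 => by simp [F, h1, h2]
  have hSu : S' u = 1 := by simp [S']
  have hSv : S' v = 1 := by simp [S']
  have hS : ∀ x, x ≠ u → x ≠ v → S' x = S x := fun x h1 h2 => by simp [S', h1, h2]
  have main : ∀ x y, G.Adj x y →
      F x ≠ F y ∧ P (F x) (F y) = S' x * S' y * edgeSign σ x y := by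
    have hend : ∀ z y, (z = u ∨ z = v) → G.Adj z y →
        F z ≠ F y ∧ P (F z) (F y) = S' z * S' y * edgeSign σ z y := by
      intro z y hz hzy
      by_cases hyu : y = u
      · subst hyu
        rcases hz with rfl | rfl
        · exact absurd hzy (G.loopless.irrefl _)
        · rw [hFu, hFv, hSu, hSv, edgeSign_comm]; simp [P]
      by_cases hyv : y = v
      · subst hyv
        rcases hz with rfl | rfl
        · rw [hFu, hFv, hSu, hSv]; simp [P]
        · exact absurd hzy (G.loopless.irrefl _)
      have := hγ z hz y hyv hyu hzy
      rcases hz with rfl | rfl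
      · rw [hFu, hF y hyu hyv, hSu, hS y hyu hyv, one_mul, ← this]; simp [P]
      · rw [hFv, hF y hyu hyv, hSv, hS y hyu hyv, one_mul, ← this]; simp [P]
    intro x y hxy
    by_cases hx : x = u ∨ x = v
    · exact hend x y hx hxy
    by_cases hy : y = u ∨ y = v
    · obtain ⟨h1, h2⟩ := hend y x hy hxy.symm
      exact ⟨h1.symm, by rw [hP, h2, edgeSign_comm, mul_comm (S' y)]⟩
    rw [not_or] at hx hy
    obtain ⟨h1, h2⟩ := hcol x ⟨hx.2, hx.1⟩ y ⟨hy.2, hy.1⟩ hxy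
    rw [hF x hx.1 hx.2, hF y hy.1 hy.2, hS x hx.1 hx.2, hS y hy.1 hy.2, ← h2]
    exact ⟨fun h => h1 (Sum.inl.inj h), rfl⟩
  have := hasHomOfOrder_of_switching σ F S' P hP (fun x y h => (main x y h).1)
    fun x y h => (main x y h).2
  simpa using this

theorem signedChromaticNumber_le_of_connectedMaxDegreeLE {Δ : ℕ} (hΔ : 29 ≤ Δ) {V : Type}
    [Fintype V] {G : SimpleGraph V} (hG : connectedMaxDegreeLE Δ V G) (σ : Signature G) :
    signedChromaticNumber σ ≤ (Δ - 1) * (Δ - 3) * 2 ^ (Δ - 1) + 2 := by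
  classical
  obtain ⟨hc, hdeg⟩ := hG
  by_cases h : ∃ u v, G.Adj u v
  · obtain ⟨u, v, huv⟩ := h
    refine signedChromaticNumber_le (hasHomOfOrder_of_adj hc (k := Δ - 1) (by omega)
      (by rw [show Δ - 1 - 2 = Δ - 3 by omega]) (fun x => ?_) σ huv)
    have := G.degree_le_maxDegree x
    have h1 : Δ - 1 + 1 = Δ := by omega
    rw [h1]
    convert this.trans ?_
    convert hdeg
  · push Not at h
    -- Without edges, one colour is enough.
    have hsub : HasHomOfOrder σ (Fintype.card Unit) := by
      exact hasHomOfOrder_of_switching σ (fun _ => ()) (fun _ => 1) (fun _ _ => 1)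
        (fun _ _ => rfl) (fun x y hxy => absurd hxy (h x y)) (fun x y hxy => absurd hxy (h x y))
    have := signedChromaticNumber_le hsub
    rw [Fintype.card_unit] at this
    omega

/-! ### Lower bound by counting signatures -/

/-- The bipartite circulant graph on two copies of `ZMod n`, in which `(x, false)` is adjacent to
`(x + d, true)` for `0 ≤ d < Δ`. -/
def bipartiteCirculant (n Δ : ℕ) : SimpleGraph (ZMod n × Bool) where
  Adj p q := (p.2 = false ∧ q.2 = true ∧ (q.1 - p.1).val < Δ) ∨
    (p.2 = true ∧ q.2 = false ∧ (p.1 - q.1).val < Δ)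
  symm := ⟨fun p q h => by tauto⟩
  loopless := ⟨fun p h => by
    rcases h with ⟨h1, h2, _⟩ | ⟨h1, h2, _⟩ <;> simp [h1] at h2⟩

theorem bipartiteCirculant_adj_add {n Δ : ℕ} [NeZero n] (hn : Δ ≤ n) (x : ZMod n) (d : Fin Δ) :
    (bipartiteCirculant n Δ).Adj (x, false) (x + (d : ℕ), true) := by
  left
  refine ⟨rfl, rfl, ?_⟩
  simp only [add_sub_cancel_left]
  rw [ZMod.val_cast_of_lt (by omega)]
  exact d.2

/-- The edges with `d = 0` and `d = 1` already connect everything; this needs `2 ≤ Δ`. -/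
theorem bipartiteCirculant_connected {n Δ : ℕ} [NeZero n] (hΔ : 2 ≤ Δ) (hn : Δ ≤ n) :
    (bipartiteCirculant n Δ).Connected := by
  have h0 : ∀ x : ZMod n, (bipartiteCirculant n Δ).Reachable (x, false) (x, true) := fun x => by
    have := (bipartiteCirculant_adj_add hn x ⟨0, by omega⟩).reachable
    simpa using this
  have h1 : ∀ x : ZMod n, (bipartiteCirculant n Δ).Reachable (x, false) (x + 1, false) :=
    fun x => by
      have := (bipartiteCirculant_adj_add hn x ⟨1, by omega⟩).reachable
      simp only [Nat.cast_one] at this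
      exact this.trans (h0 _).symm
  have h2 : ∀ m : ℕ, (bipartiteCirculant n Δ).Reachable (0, false) ((m : ZMod n), false) := by
    intro m
    induction m with
    | zero => simp
    | succ m ih => rw [Nat.cast_succ]; exact ih.trans (h1 _)
  have h3 : ∀ p, (bipartiteCirculant n Δ).Reachable (0, false) p := by
    rintro ⟨x, b⟩
    have := h2 x.val
    rw [ZMod.natCast_zmod_val] at this
    cases b
    · exact this
    · exact this.trans (h0 x)
  exact ⟨fun p q => (h3 p).symm.trans (h3 q)⟩

open Classical in
theorem bipartiteCirculant_degree_le {n Δ : ℕ} [NeZero n] (p : ZMod n × Bool) :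
    (bipartiteCirculant n Δ).degree p ≤ Δ := by
  obtain ⟨x, b⟩ := p
  rw [← SimpleGraph.card_neighborFinset_eq_degree]
  cases b
  · have : (bipartiteCirculant n Δ).neighborFinset (x, false) ⊆
        (Finset.range Δ).image fun d : ℕ => (x + (d : ZMod n), true) := by
      rintro ⟨y, b⟩ hy
      rw [SimpleGraph.mem_neighborFinset] at hy
      rcases hy with ⟨-, h1, h2⟩ | ⟨h1, -⟩
      · refine Finset.mem_image.2 ⟨(y - x).val, Finset.mem_range.2 h2, ?_⟩
        rw [ZMod.natCast_zmod_val, add_sub_cancel]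
        exact Prod.ext rfl h1.symm
      · simp at h1
    simpa using (Finset.card_le_card this).trans Finset.card_image_le
  · have : (bipartiteCirculant n Δ).neighborFinset (x, true) ⊆
        (Finset.range Δ).image fun d : ℕ => (x - (d : ZMod n), false) := by
      rintro ⟨y, b⟩ hy
      rw [SimpleGraph.mem_neighborFinset] at hy
      rcases hy with ⟨h1, -⟩ | ⟨-, h1, h2⟩
      · simp at h1
      · refine Finset.mem_image.2 ⟨(x - y).val, Finset.mem_range.2 h2, ?_⟩
        rw [ZMod.natCast_zmod_val, sub_sub_cancel]
        exact Prod.ext rfl h1.symm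
    simpa using (Finset.card_le_card this).trans Finset.card_image_le

/-- Every assignment of signs to the pairs `(x, d)` comes from a signature of the bipartite
circulant graph. -/
theorem exists_signature_bipartiteCirculant {n Δ : ℕ} [NeZero n] (hn : Δ ≤ n)
    (τ : ZMod n → Fin Δ → ℤˣ) :
    ∃ σ : Signature (bipartiteCirculant n Δ), ∀ (x : ZMod n) (d : Fin Δ),
      edgeSign σ (x, false) (x + (d : ℕ), true) = τ x d := by
  classical
  -- As `Δ ≤ n`, the shift `d` is recovered from the ends of the edge.
  let T : ZMod n → ZMod n → ℤˣ := fun x y =>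
    if h : (y - x).val < Δ then τ x ⟨(y - x).val, h⟩ else 1
  let Q : ZMod n × Bool → ZMod n × Bool → ℤˣ := fun p q =>
    if p.2 = q.2 then 1 else if p.2 = false then T p.1 q.1 else T q.1 p.1
  have hQ : ∀ p q, Q p q = Q q p := by
    rintro ⟨x, _ | _⟩ ⟨y, _ | _⟩ <;> simp [Q]
  refine ⟨fun e => Sym2.lift ⟨Q, hQ⟩ e.1, fun x d => ?_⟩
  rw [edgeSign_of_adj _ (bipartiteCirculant_adj_add hn x d)]
  have hd : ((d : ℕ) : ZMod n).val = d := ZMod.val_cast_of_lt (by omega)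
  simp [Q, T, hd]

/-- Signatures of the bipartite circulant graph are determined by a colouring, a switching and the
signs of the target. -/
theorem two_pow_le_of_signedChromaticNumber_le {n Δ k : ℕ} [NeZero n] (hΔ : 2 ≤ Δ) (hn : Δ ≤ n)
    (hk : ∀ σ : Signature (bipartiteCirculant n Δ), signedChromaticNumber σ ≤ k) :
    (2 ^ Δ) ^ n ≤ (4 * k ^ 2) ^ n * 2 ^ k ^ 2 := by
  classical
  let D := (ZMod n × Bool → Fin k) × (ZMod n × Bool → ℤˣ) × (Fin k → Fin k → ℤˣ)
  let Φ : D → ZMod n → Fin Δ → ℤˣ := fun q x d =>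
    q.2.1 (x, false) * q.2.1 (x + (d : ℕ), true) *
      q.2.2 (q.1 (x, false)) (q.1 (x + (d : ℕ), true))
  have hΦ : Function.Surjective Φ := by
    intro τ
    obtain ⟨σ, hσ⟩ := exists_signature_bipartiteCirculant hn τ
    obtain ⟨F, S, P, h⟩ := (hasHomOfOrder_signedChromaticNumber σ).exists_coloring
      (bipartiteCirculant_connected hΔ hn) (hk σ)
    refine ⟨(F, S, P), ?_⟩
    funext x d
    rw [← hσ x d, h _ _ (bipartiteCirculant_adj_add hn x d)]
  have := Fintype.card_le_of_surjective Φ hΦ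
  simp only [D, Fintype.card_prod, Fintype.card_fun, Fintype.card_units_int, Fintype.card_fin,
    ZMod.card, Fintype.card_bool] at this
  calc (2 ^ Δ) ^ n ≤ _ := this
    _ = _ := by
      rw [mul_comm n 2, pow_mul k 2 n, pow_mul 2 2 n, ← pow_mul 2 k k, ← sq k, mul_pow]
      norm_num
      ring

theorem connectedMaxDegreeLE_unit {Δ : ℕ} (hΔ : 1 ≤ Δ) (G : SimpleGraph Unit) :
    connectedMaxDegreeLE Δ Unit G := by
  classical
  exact ⟨⟨fun _ _ => SimpleGraph.Reachable.refl _⟩,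
    SimpleGraph.maxDegree_le_of_forall_degree_le _ _ fun v =>
      (G.degree_lt_card_verts v).le.trans (by rwa [Fintype.card_unit])⟩

/-- The factor `2 ^ (k ^ 2)` from the target signs does not depend on `n`, so a ratio `2 ^ Δ / (4 k
^ 2) > 1` would beat it for large `n`. -/
theorem two_pow_le_four_mul_sq {Δ k : ℕ} (hΔ : 2 ≤ Δ)
    (hk : ∀ m ∈ signedChromaticNumbers (connectedMaxDegreeLE Δ), m ≤ k) :
    2 ^ Δ ≤ 4 * k ^ 2 := by
  classical
  by_contra! hlt
  have key : ∀ n, Δ ≤ n → (2 ^ Δ) ^ n ≤ (4 * k ^ 2) ^ n * 2 ^ k ^ 2 := by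
    intro n hn
    have : NeZero n := ⟨by omega⟩
    refine two_pow_le_of_signedChromaticNumber_le hΔ hn fun σ => hk _
      ⟨ZMod n × Bool, inferInstance, bipartiteCirculant n Δ, σ,
        ⟨bipartiteCirculant_connected hΔ hn, ?_⟩, rfl⟩
    exact SimpleGraph.maxDegree_le_of_forall_degree_le _ _ fun p => by
      convert bipartiteCirculant_degree_le p
  have hk0 : (0 : ℝ) < 4 * k ^ 2 := by
    have h := key Δ le_rfl
    rcases Nat.eq_zero_or_pos k with rfl | hk0
    · have hp : 0 < (2 ^ Δ) ^ Δ := by positivity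
      simp [show Δ ≠ 0 by omega] at h
    · positivity
  have hr : (1 : ℝ) < 2 ^ Δ / (4 * k ^ 2) := by
    rw [one_lt_div hk0]; exact_mod_cast hlt
  obtain ⟨n, hn, hnΔ⟩ := (((tendsto_pow_atTop_atTop_of_one_lt hr).eventually_gt_atTop
    ((2 : ℝ) ^ k ^ 2)).and (Filter.eventually_ge_atTop Δ)).exists
  rw [div_pow, lt_div_iff₀ (by positivity)] at hn
  have h : ((2 : ℝ) ^ Δ) ^ n ≤ (4 * k ^ 2) ^ n * 2 ^ k ^ 2 := by exact_mod_cast key n hnΔ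
  linarith

end SignedGraph

/-! ### Existence of the maximum and the two bounds -/

theorem theorem1p11 (Δ : ℕ) (hΔ : 29 ≤ Δ) :
    ∃ k : ℕ, SignedGraph.IsSignedChromaticNumberOf (SignedGraph.connectedMaxDegreeLE Δ) k ∧
      (2 : ℝ) ^ ((Δ : ℝ) / 2 - 1) ≤ (k : ℝ) ∧
      (k : ℝ) ≤ ((Δ : ℝ) - 3) * ((Δ : ℝ) - 1) * 2 ^ ((Δ : ℝ) - 1) + 2 := by
  have hup : ∀ m ∈ SignedGraph.signedChromaticNumbers (SignedGraph.connectedMaxDegreeLE Δ),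
      m ≤ (Δ - 1) * (Δ - 3) * 2 ^ (Δ - 1) + 2 := by
    rintro m ⟨V, _, G, σ, hG, rfl⟩
    exact SignedGraph.signedChromaticNumber_le_of_connectedMaxDegreeLE hΔ hG σ
  have hne : (SignedGraph.signedChromaticNumbers
      (SignedGraph.connectedMaxDegreeLE Δ)).Nonempty :=
    ⟨_, Unit, inferInstance, ⊥, fun _ => 1,
      SignedGraph.connectedMaxDegreeLE_unit (by omega) ⊥, rfl⟩
  have hbdd : BddAbove (SignedGraph.signedChromaticNumbers
      (SignedGraph.connectedMaxDegreeLE Δ)) := ⟨_, hup⟩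
  have hmem := Nat.sSup_mem hne hbdd
  set k := sSup (SignedGraph.signedChromaticNumbers (SignedGraph.connectedMaxDegreeLE Δ))
  have hk : ∀ m ∈ SignedGraph.signedChromaticNumbers (SignedGraph.connectedMaxDegreeLE Δ),
      m ≤ k := fun m hm => le_csSup hbdd hm
  refine ⟨k, ⟨hmem, hk⟩, ?_, ?_⟩
  · have h : (2 : ℝ) ^ Δ ≤ 4 * k ^ 2 := by
      exact_mod_cast SignedGraph.two_pow_le_four_mul_sq (by omega) hk
    -- Comparing squares reduces the bound to `2 ^ (Δ - 2) ≤ k ^ 2`.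
    refine abs_le_of_sq_le_sq' ?_ (Nat.cast_nonneg k) |>.2
    rw [← Real.rpow_natCast, ← Real.rpow_mul (by norm_num),
      show ((Δ : ℝ) / 2 - 1) * ((2 : ℕ) : ℝ) = (Δ : ℝ) - 2 by push_cast; ring,
      Real.rpow_sub (by norm_num), Real.rpow_natCast]
    rw [div_le_iff₀ (by positivity)]
    norm_num
    linarith
  · have h : (k : ℝ) ≤ (((Δ - 1) * (Δ - 3) * 2 ^ (Δ - 1) + 2 : ℕ) : ℝ) := by
      exact_mod_cast hup k hmem
    push_cast [Nat.cast_sub (show 1 ≤ Δ by omega), Nat.cast_sub (show 3 ≤ Δ by omega)] at h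
    have hpow : (2 : ℝ) ^ ((Δ : ℝ) - 1) = 2 ^ (Δ - 1) := by
      rw [← Real.rpow_natCast, Nat.cast_sub (by omega)]; norm_num
    rw [hpow, mul_comm ((Δ : ℝ) - 3)]
    exact h
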